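/- Corollary 3.5 (Trotter number with commutator scaling). Let $p\ge 1$ and $\Upsilon\ge 0$ be fixed integers. Let $H=\sum_{\gamma=1}^{\Gamma}H_\gamma$, where the $H_\gamma$ are anti-Hermitian operators on a finite-dimensional complex Hilbert space, and let $$\mathscr S(t)=\prod_{\upsilon=1}^{\Upsilon}\prod_{\gamma=1}^{\Gamma}e^{t\,a_{(\upsilon,\gamma)}H_{\pi_\upsilon(\gamma)}}$$ (in both products the indices increase from right to left) be a product formula with $\Upsilon$ stages, where the $\pi_\upsilon$ are permutations of $\{1,\dots,\Gamma\}$ and the coefficients $a_{(\upsilon,\gamma)}$ are real with $|a_{(\upsilon,\gamma)}|\le 1$. Suppose that it is of $p$th order, i.e. $\mathscr S(t)=e^{tH}+O(t^{p+1})$ as $t\to 0$, $t\in\mathbb R$. Put $$\widetilde\alpha_{\mathrm{comm}}=\sum_{\gamma_1,\dots,\gamma_{p+1}=1}^{\Gamma}\bigl\|[H_{\gamma_{p+1}},\cdots[H_{\gamma_2},H_{\gamma_1}]]\bigr\|,\qquad X=\frac{\widetilde\alpha_{\mathrm{comm}}^{1/p}\,t^{1+1/p}}{\epsilon^{1/p}},$$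 where $\|\cdot\|$ is the spectral norm. Then $r=\mathcal O(X)$ Trotter steps suffice to achieve $\|\mathscr S(t/r)^r-e^{tH}\|=\mathcal O(\epsilon)$, in the following uniform sense. (i) For every $c>0$ there is a constant $C>0$, depending only on $p$, $\Upsilon$ and $c$, such that for all such $H_\gamma$, $a$, $\pi$ (in any dimension and with any $\Gamma$), all $t\ge 0$, $\epsilon>0$ and all integers $r\ge 1$ with $r\ge cX$, $$\|\mathscr S(t/r)^r-e^{tH}\|\le C\epsilon .$$ (ii) There is a constant $C>0$, depending only on $p$ and $\Upsilon$, such that for all such $H_\gamma$, $a$, $\pi$ and all $t\ge 0$, $\epsilon>0$ there is an integer $r\ge 1$ with $r\le 1+CX$ and $$\|\mathscr S(t/r)^r-e^{tH}\|\le \epsilon .$$ -/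

import Mathlib

open Filter Topology Asymptotics
open scoped Matrix.Norms.L2Operator

/-! Operators on a finite-dimensional Hilbert space are complex square matrices; with the opened
scope, `‖A‖` is the spectral norm (the operator norm for the Euclidean norm on `ℂ^d`). -/

noncomputable section

namespace Trotter

/-- Operators on `ℂ^d`. -/
abbrev Op (d : ℕ) : Type := Matrix (Fin d) (Fin d) ℂ

/-- The product `A_n ⋯ A_2 A_1`, in which the indices increase from right to left. -/
def leftProd {d n : ℕ} (A : Fin n → Op d) : Op d :=
  (List.ofFn A).reverse.prod

/-- The product formula
`S(t) = ∏_{υ=1}^{Υ} ∏_{γ=1}^{Γ} exp (t a_{(υ,γ)} H_{π_υ(γ)})` with `Υ` stages, where in both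
products the indices increase from right to left. -/
def productFormula {d Υ Γ : ℕ} (a : Fin Υ → Fin Γ → ℝ) (π : Fin Υ → Equiv.Perm (Fin Γ))
    (H : Fin Γ → Op d) (t : ℝ) : Op d :=
  leftProd fun υ : Fin Υ => leftProd fun γ : Fin Γ =>
    NormedSpace.exp ((t * a υ γ) • H (π υ γ))

/-- The exact evolution `e^{tH}` generated by `H = ∑_γ H_γ`. -/
def evolution {d Γ : ℕ} (H : Fin Γ → Op d) (t : ℝ) : Op d :=
  NormedSpace.exp (t • ∑ γ, H γ)

/-- The product formula is of `p`th order for the summands `H_γ`: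
`S(t) = e^{tH} + O(t^{p+1})` as the real variable `t` tends to `0`. -/
def IsOrder {d Υ Γ : ℕ} (p : ℕ) (a : Fin Υ → Fin Γ → ℝ) (π : Fin Υ → Equiv.Perm (Fin Γ))
    (H : Fin Γ → Op d) : Prop :=
  (fun t : ℝ => productFormula a π H t - evolution H t) =O[𝓝 0] fun t : ℝ => t ^ (p + 1)

/-- The right-nested commutator `[A_n, [A_{n-1}, ⋯ [A_1, A_0]]]`. -/
def nestedCommutator {d : ℕ} : (n : ℕ) → (Fin (n + 1) → Op d) → Op d
  | 0, A => A 0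
  | n + 1, A => ⁅A (Fin.last (n + 1)), nestedCommutator n fun i => A i.castSucc⁆

/-- `α̃_comm = ∑_{γ_1, …, γ_{p+1}} ‖[H_{γ_{p+1}}, ⋯ [H_{γ_2}, H_{γ_1}]]‖`. -/
def alphaComm {d Γ : ℕ} (p : ℕ) (H : Fin Γ → Op d) : ℝ :=
  ∑ g : Fin (p + 1) → Fin Γ, ‖nestedCommutator p fun i => H (g i)‖

/-- The scale `α̃_comm^{1/p} t^{1+1/p} / ε^{1/p}` of the number of Trotter steps. -/
def trotterScale {d Γ : ℕ} (p : ℕ) (H : Fin Γ → Op d) (t ε : ℝ) : ℝ :=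
  alphaComm p H ^ (1 / p : ℝ) * t ^ (1 + 1 / p : ℝ) / ε ^ (1 / p : ℝ)

end Trotter

end

/-!
Write `S(t)` for the product formula, a product `e^{t A_m} ⋯ e^{t A_1}` with `m = ΥΓ` factors whose
exponents are the multiples `A_j = a_{(υ,γ)} H_{π_υ(γ)}`. Its logarithmic derivative is
`S' S⁻¹ = ∑_j S_j A_j S_j⋆` with `S_j = e^{t A_m} ⋯ e^{t A_{j+1}}`, so the local error is governed by
`T(t) = S' S⁻¹ - H`: as everything in sight is unitary, variation of constants gives
`‖S(t) - e^{tH}‖ ≤ ∫_0^t ‖T‖`.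

Expand the conjugations in `S_j A_j S_j⋆` one exponential at a time, from the inside out, and stop
each Taylor expansion as soon as the total degree reaches `p`. The remainders are `p`-fold nested
commutators, conjugated by unitaries, and the norm does not see the conjugation. Hence `T` is a
polynomial of degree less than `p` plus a remainder of norm at most `K t ^ p`, where `K` is a sum
of norms of nested commutators of the `A_j` (`hasExpansion_expProd_conj`, `hasExpansion_logDeriv`).
The order condition gives `T(t) = O(t ^ p)` as `t → 0`, because `S(t) - e^{tH}` is analytic and may
be differentiated; so the polynomial part vanishes, and `‖T(t)‖ ≤ K t ^ p` for all `t ≥ 0`, not only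
small ones (`HasExpansion.norm_le`, `norm_expProd_sub_exp_le`).

Every stage uses each `H_γ` once with a coefficient of modulus at most `1`, and `K` runs over words
of length `p + 1` in the `A_j`, whence `K ≤ Υ ^ (p + 1) * α̃_comm`
(`norm_productFormula_sub_evolution_le`). Telescoping over `r` unitary steps then bounds the total
error by `Υ ^ (p + 1) * α̃_comm * t ^ (p + 1) / r ^ p`, which is the claim rewritten through the
`p`th power of the Trotter scale.
-/

/-! ### Functions with a Taylor polynomial and a remainder bound on the half-line -/

namespace Trotter

section Expansion

variable {E : Type*} [NormedAddCommGroup E] [NormedSpace ℝ E]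

/-- `f` differs from some polynomial of degree less than `p`, with coefficients in `E`, by at most
`K * t ^ p` at every `t ≥ 0`. Only the values of `c k` with `k < p` matter. -/
def HasExpansion (f : ℝ → E) (p : ℕ) (K : ℝ) : Prop :=
  ∃ c : ℕ → E, ∀ t : ℝ, 0 ≤ t → ‖f t - ∑ k ∈ Finset.range p, t ^ k • c k‖ ≤ K * t ^ p

theorem HasExpansion.mono {f : ℝ → E} {p : ℕ} {K K' : ℝ} (hf : HasExpansion f p K) (h : K ≤ K') :
    HasExpansion f p K' := by
  obtain ⟨c, hc⟩ := hf
  exact ⟨c, fun t ht => (hc t ht).trans (by gcongr)⟩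

theorem HasExpansion.add {f g : ℝ → E} {p : ℕ} {K K' : ℝ} (hf : HasExpansion f p K)
    (hg : HasExpansion g p K') : HasExpansion (fun t => f t + g t) p (K + K') := by
  obtain ⟨c, hc⟩ := hf
  obtain ⟨c', hc'⟩ := hg
  refine ⟨fun k => c k + c' k, fun t ht => ?_⟩
  simp only [smul_add, Finset.sum_add_distrib, add_mul]
  rw [add_sub_add_comm]
  exact (norm_add_le _ _).trans (add_le_add (hc t ht) (hc' t ht))

theorem hasExpansion_sum {ι : Type*} (s : Finset ι) {f : ι → ℝ → E} {p : ℕ} {K : ι → ℝ}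
    (hf : ∀ i ∈ s, HasExpansion (f i) p (K i)) :
    HasExpansion (fun t => ∑ i ∈ s, f i t) p (∑ i ∈ s, K i) := by
  classical
  induction s using Finset.induction_on with
  | empty => exact ⟨0, fun t _ => by simp⟩
  | insert i s hi ih =>
    simp only [Finset.sum_insert hi]
    exact (hf i (by simp)).add (ih fun j hj => hf j (by simp [hj]))

theorem hasExpansion_const (b : E) {p : ℕ} (hp : 1 ≤ p) : HasExpansion (fun _ => b) p 0 := by
  refine ⟨Pi.single 0 b, fun t _ => ?_⟩
  rw [Finset.sum_eq_single_of_mem 0 (Finset.mem_range.2 hp)]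
  · simp
  · intro k _ hk
    simp [hk]

theorem hasExpansion_of_norm_le {f : ℝ → E} {p : ℕ} {K : ℝ}
    (h : ∀ t : ℝ, 0 ≤ t → ‖f t‖ ≤ K * t ^ p) : HasExpansion f p K :=
  ⟨0, fun t ht => by simpa using h t ht⟩

theorem HasExpansion.pow_smul {f : ℝ → E} {p : ℕ} {K : ℝ} (hf : HasExpansion f p K) (m : ℕ)
    {a : ℝ} (ha : |a| ≤ 1) :
    HasExpansion (fun t => (a * t ^ m) • f t) (m + p) K := by
  obtain ⟨c, hc⟩ := hf
  refine ⟨fun k => if k < m then 0 else a • c (k - m), fun t ht => ?_⟩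
  have hsum : ∑ k ∈ Finset.range (m + p), t ^ k • (if k < m then 0 else a • c (k - m)) =
      (a * t ^ m) • ∑ k ∈ Finset.range p, t ^ k • c k := by
    rw [Finset.sum_range_add, Finset.sum_eq_zero, zero_add, Finset.smul_sum]
    · refine Finset.sum_congr rfl fun k _ => ?_
      simp only [add_lt_iff_neg_left, not_lt_zero, if_false, add_tsub_cancel_left, smul_smul]
      congr 1
      ring
    · intro k hk
      simp [Finset.mem_range.1 hk]
  rw [hsum, ← smul_sub, norm_smul, norm_mul, Real.norm_eq_abs, norm_pow, Real.norm_of_nonneg ht]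
  calc |a| * t ^ m * ‖f t - ∑ k ∈ Finset.range p, t ^ k • c k‖
      ≤ 1 * t ^ m * (K * t ^ p) := by
        gcongr
        exact hc t ht
    _ = K * t ^ (m + p) := by ring

/-- A polynomial of degree less than `p` that is `O(t ^ p)` as `t → 0+` vanishes. -/
theorem coeff_eq_zero_of_isBigO {p : ℕ} : ∀ {c : ℕ → E},
    ((fun t : ℝ => ∑ k ∈ Finset.range p, t ^ k • c k) =O[𝓝[>] 0] fun t : ℝ => t ^ p) →
    ∀ k < p, c k = 0 := by
  induction p with
  | zero => intro c _ k hk; omega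
  | succ p ih =>
    intro c h
    have hc0 : c 0 = 0 := by
      have h1 : Tendsto (fun t : ℝ => ∑ k ∈ Finset.range (p + 1), t ^ k • c k) (𝓝[>] 0)
          (𝓝 (∑ k ∈ Finset.range (p + 1), (0 : ℝ) ^ k • c k)) :=
        (Continuous.tendsto (by fun_prop) 0).mono_left nhdsWithin_le_nhds
      have h2 : Tendsto (fun t : ℝ => t ^ (p + 1)) (𝓝[>] 0) (𝓝 0) := by
        have := (continuous_pow (M := ℝ) (p + 1)).tendsto 0
        simp only [ne_eq, Nat.add_eq_zero_iff, one_ne_zero, and_false, not_false_eq_true,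
          zero_pow] at this
        exact this.mono_left nhdsWithin_le_nhds
      have h3 := tendsto_nhds_unique h1 (h.trans_tendsto h2)
      rw [Finset.sum_range_succ'] at h3
      simpa using h3
    have hshift : (fun t : ℝ => ∑ k ∈ Finset.range p, t ^ k • c (k + 1)) =O[𝓝[>] 0]
        fun t : ℝ => t ^ p := by
      obtain ⟨C, hC⟩ := h.bound
      refine IsBigO.of_bound C ?_
      filter_upwards [hC, self_mem_nhdsWithin] with t ht htpos
      have htpos : (0 : ℝ) < t := htpos
      rw [Finset.sum_range_succ', hc0] at ht
      simp only [pow_succ', smul_zero, add_zero, ← smul_smul, ← Finset.smul_sum] at ht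
      rw [norm_smul, norm_mul, Real.norm_of_nonneg htpos.le, mul_left_comm] at ht
      exact le_of_mul_le_mul_left ht htpos
    intro k hk
    cases k with
    | zero => exact hc0
    | succ k => exact ih hshift k (by omega)

/-- Vanishing to order `p` at `0+` upgrades an expansion to a bound on the whole half-line. -/
theorem HasExpansion.norm_le {f : ℝ → E} {p : ℕ} {K : ℝ} (hf : HasExpansion f p K)
    (h : f =O[𝓝[>] 0] fun t : ℝ => t ^ p) {t : ℝ} (ht : 0 ≤ t) : ‖f t‖ ≤ K * t ^ p := by
  obtain ⟨c, hc⟩ := hf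
  have hrem : (fun t : ℝ => f t - ∑ k ∈ Finset.range p, t ^ k • c k) =O[𝓝[>] 0]
      fun t : ℝ => t ^ p := by
    refine IsBigO.of_bound K ?_
    filter_upwards [self_mem_nhdsWithin] with s hs
    have hs : (0 : ℝ) < s := hs
    rw [norm_pow, Real.norm_of_nonneg hs.le]
    exact hc s hs.le
  have hpoly := coeff_eq_zero_of_isBigO (p := p) (c := c) (by simpa using h.sub hrem)
  have hsum : ∑ k ∈ Finset.range p, t ^ k • c k = 0 :=
    Finset.sum_eq_zero fun k hk => by rw [hpoly k (Finset.mem_range.1 hk), smul_zero]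
  simpa [hsum] using hc t ht

/-- Differentiation lowers the order of vanishing of an analytic function by at most one. -/
theorem isBigO_deriv_of_analyticAt [CompleteSpace E] {f : ℝ → E} (hf : AnalyticAt ℝ f 0) {n : ℕ}
    (h : f =O[𝓝 0] fun t : ℝ => t ^ (n + 1)) : deriv f =O[𝓝 0] fun t : ℝ => t ^ n := by
  obtain ⟨g, hg, hfg⟩ := hf.exists_eventuallyEq_sum_add_pow_mul (n + 1)
  have hgO : (fun t : ℝ => t ^ (n + 1) • g t) =O[𝓝 0] fun t : ℝ => t ^ (n + 1) := by
    simpa using (isBigO_refl (fun t : ℝ => t ^ (n + 1)) (𝓝 0)).smul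
      (hg.continuousAt.isBigO_one ℝ)
  -- The Taylor polynomial of `f` of degree `n` vanishes.
  have hcoeff := coeff_eq_zero_of_isBigO (p := n + 1)
    (c := fun k => ((k.factorial : ℝ)⁻¹) • iteratedDeriv k f 0) <| by
      refine ((h.sub hgO).congr' ?_ EventuallyEq.rfl).mono nhdsWithin_le_nhds
      filter_upwards [hfg] with t ht
      simp [ht, smul_smul, div_eq_mul_inv]
  have hf_eq : f =ᶠ[𝓝 0] fun t => t ^ (n + 1) • g t := by
    filter_upwards [hfg] with t ht
    rw [ht, Finset.sum_eq_zero, zero_add]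
    intro k hk
    rw [div_eq_mul_inv, ← smul_smul, hcoeff k (Finset.mem_range.1 hk), smul_zero]
  have hderiv : deriv f =ᶠ[𝓝 0]
      fun t => t ^ n • (t • deriv g t + ((n : ℝ) + 1) • g t) := by
    filter_upwards [hf_eq.deriv, hg.eventually_analyticAt] with t ht hgt
    rw [ht]
    have := (hasDerivAt_pow (n + 1) t).smul hgt.differentiableAt.hasDerivAt
    refine this.deriv.trans ?_
    simp only [smul_add, smul_smul, pow_succ, add_tsub_cancel_right, Nat.cast_add, Nat.cast_one]
    congr 2
    ring
  have hcont : ContinuousAt (fun t : ℝ => t • deriv g t + ((n : ℝ) + 1) • g t) 0 :=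
    (continuousAt_id.smul hg.deriv.continuousAt).add (hg.continuousAt.const_smul _)
  refine IsBigO.congr' ?_ hderiv.symm EventuallyEq.rfl
  simpa using (isBigO_refl (fun t : ℝ => t ^ n) (𝓝 0)).smul (hcont.isBigO_one ℝ)

/-- The mean value inequality for a derivative bounded by a monomial. -/
theorem norm_le_of_hasDerivAt_of_norm_le_pow {f f' : ℝ → E} (hf : ∀ t, HasDerivAt f (f' t) t)
    (h0 : f 0 = 0) {K : ℝ} {p : ℕ} (hK : ∀ t, 0 ≤ t → ‖f' t‖ ≤ K * t ^ p) {t : ℝ} (ht : 0 ≤ t) :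
    ‖f t‖ ≤ K / (p + 1) * t ^ (p + 1) := by
  refine image_norm_le_of_norm_deriv_right_le_deriv_boundary (a := 0) (b := t) (f' := f')
    (B := fun s => K / (p + 1) * s ^ (p + 1)) (B' := fun s => K * s ^ p)
    (fun s _ => (hf s).continuousAt.continuousWithinAt) (fun s _ => (hf s).hasDerivWithinAt)
    (by simp [h0]) (fun s => ?_) (fun s hs => hK s hs.1) ⟨ht, le_rfl⟩
  refine ((hasDerivAt_pow (p + 1) s).const_mul (K / (p + 1))).congr_deriv ?_
  have : (p : ℝ) + 1 ≠ 0 := by positivity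
  push_cast
  field_simp

end Expansion

end Trotter

namespace Trotter

/-! ### Sums of nested commutators -/

section Commutator

variable {𝔸 : Type*} [NormedRing 𝔸]

/-- The sum of `‖[X_q, ⋯ [X_1, B]]‖` over all words `X_1, …, X_q` of length `q` in the entries of
`L`, counted with multiplicity. -/
noncomputable def commSum (L : List 𝔸) : ℕ → 𝔸 → ℝ
  | 0, B => ‖B‖
  | q + 1, B => (L.map fun A => commSum L q ⁅A, B⁆).sum

theorem commSum_nonneg (L : List 𝔸) (q : ℕ) (B : 𝔸) : 0 ≤ commSum L q B := by
  induction q generalizing B with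
  | zero => exact norm_nonneg B
  | succ q ih =>
    refine List.sum_nonneg fun x hx => ?_
    obtain ⟨A, -, rfl⟩ := List.mem_map.1 hx
    exact ih _

theorem commSum_le_commSum_cons (A : 𝔸) (L : List 𝔸) (q : ℕ) (B : 𝔸) :
    commSum L q B ≤ commSum (A :: L) q B := by
  induction q generalizing B with
  | zero => exact le_rfl
  | succ q ih =>
    simp only [commSum, List.map_cons, List.sum_cons]
    exact (List.sum_le_sum fun X _ => ih _).trans
      (le_add_of_nonneg_left (commSum_nonneg _ _ _))

/-- The words `A ⋯ A X_{k+1} ⋯ X_q` with `X_i ∈ L` are among those in the entries of `A :: L`. -/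
theorem sum_commSum_iterate_le (A : 𝔸) (L : List 𝔸) (q : ℕ) (B : 𝔸) :
    ∑ k ∈ Finset.range (q + 1), commSum L (q - k) ((fun X => ⁅A, X⁆)^[k] B) ≤
      commSum (A :: L) q B := by
  induction q generalizing B with
  | zero => simp [commSum]
  | succ q ih =>
    rw [Finset.sum_range_succ', add_comm]
    simp only [Nat.add_sub_add_right, Function.iterate_succ_apply, Function.iterate_zero_apply,
      tsub_zero]
    rw [commSum, commSum, List.map_cons, List.sum_cons, add_comm (commSum _ _ _)]
    exact add_le_add (List.sum_le_sum fun X _ => commSum_le_commSum_cons A L q _) (ih _)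

variable [NormedAlgebra ℝ 𝔸]

theorem commSum_smul (M : List 𝔸) (q : ℕ) (a : ℝ) (B : 𝔸) :
    commSum M q (a • B) = |a| * commSum M q B := by
  induction q generalizing B with
  | zero => simp [commSum, norm_smul]
  | succ q ih =>
    have : ∀ X : 𝔸, ⁅X, a • B⁆ = a • ⁅X, B⁆ := fun X => by
      simp only [Ring.lie_def, mul_smul_comm, smul_mul_assoc, smul_sub]
    simp only [commSum, this, ih, List.sum_map_mul_left]

/-- If sums over `L` are dominated by `c` times sums over `M`, then each of the `q` letters of a word
contributes one factor `c`. It is enough to compare the sums of nonnegative, absolutely homogeneous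
functions, since `commSum` has this property in each letter; this lets `L` consist of multiples of
the entries of `M`. -/
theorem commSum_le_pow_mul {L M : List 𝔸} {c : ℝ} (hc : 0 ≤ c)
    (hLM : ∀ f : 𝔸 → ℝ, (∀ A, 0 ≤ f A) → (∀ (a : ℝ) A, f (a • A) = |a| * f A) →
      (L.map f).sum ≤ c * (M.map f).sum) (q : ℕ) (B : 𝔸) :
    commSum L q B ≤ c ^ q * commSum M q B := by
  induction q generalizing B with
  | zero => simp [commSum]
  | succ q ih =>
    calc commSum L (q + 1) B ≤ (L.map fun A => c ^ q * commSum M q ⁅A, B⁆).sum :=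
          List.sum_le_sum fun A _ => ih ⁅A, B⁆
      _ = c ^ q * (L.map fun A => commSum M q ⁅A, B⁆).sum := List.sum_map_mul_left _ _ _
      _ ≤ c ^ q * (c * (M.map fun A => commSum M q ⁅A, B⁆).sum) := by
          gcongr
          refine hLM _ (fun A => commSum_nonneg _ _ _) fun a A => ?_
          rw [← commSum_smul]
          congr 1
          simp only [Ring.lie_def, mul_smul_comm, smul_mul_assoc, smul_sub]
      _ = c ^ (q + 1) * commSum M (q + 1) B := by rw [commSum]; ring

theorem sum_commSum_le_pow_mul {L M : List 𝔸} {c : ℝ} (hc : 0 ≤ c)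
    (hLM : ∀ f : 𝔸 → ℝ, (∀ A, 0 ≤ f A) → (∀ (a : ℝ) A, f (a • A) = |a| * f A) →
      (L.map f).sum ≤ c * (M.map f).sum) (q : ℕ) :
    (L.map (commSum L q)).sum ≤ c ^ (q + 1) * (M.map (commSum M q)).sum := by
  calc (L.map (commSum L q)).sum ≤ (L.map fun A => c ^ q * commSum M q A).sum :=
        List.sum_le_sum fun A _ => commSum_le_pow_mul hc hLM q A
    _ = c ^ q * (L.map (commSum M q)).sum := List.sum_map_mul_left _ _ _
    _ ≤ c ^ q * (c * (M.map (commSum M q)).sum) := by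
        gcongr
        exact hLM _ (fun A => commSum_nonneg _ _ _) fun a A => commSum_smul M q a A
    _ = c ^ (q + 1) * (M.map (commSum M q)).sum := by ring

end Commutator

/-! ### Products of exponentials -/

section Exponential

variable {𝔸 : Type*} [NormedRing 𝔸] [NormedAlgebra ℝ 𝔸]

/-- The product `e^{t A_m} ⋯ e^{t A_1}` for the list `[A_1, …, A_m]`: the head of the list is the
rightmost factor. -/
noncomputable def expProd (L : List 𝔸) (t : ℝ) : 𝔸 :=
  (L.map fun A => NormedSpace.exp (t • A)).reverse.prod

theorem expProd_cons (A : 𝔸) (L : List 𝔸) (t : ℝ) :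
    expProd (A :: L) t = expProd L t * NormedSpace.exp (t • A) := by
  simp [expProd]

variable [CompleteSpace 𝔸]

theorem analyticAt_exp_smul (A : 𝔸) (t : ℝ) :
    AnalyticAt ℝ (fun s : ℝ => NormedSpace.exp (s • A)) t :=
  AnalyticAt.fun_comp (f := fun s : ℝ => s • A) (NormedSpace.exp_analytic (t • A))
    (analyticAt_id.smul analyticAt_const)

theorem analyticAt_expProd (L : List 𝔸) (t : ℝ) : AnalyticAt ℝ (expProd L) t := by
  induction L with
  | nil => exact analyticAt_const
  | cons A L ih =>
    rw [show expProd (A :: L) = fun s => expProd L s * NormedSpace.exp (s • A) from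
      funext fun s => expProd_cons A L s]
    exact ih.mul (analyticAt_exp_smul A t)

end Exponential

section Unitary

theorem norm_mul_mul_star_of_mem_unitary {𝔸 : Type*} [NormedRing 𝔸] [StarRing 𝔸] [CStarRing 𝔸]
    {U : 𝔸} (hU : U ∈ unitary 𝔸) (B : 𝔸) :
    ‖U * B * star U‖ = ‖B‖ := by
  rw [CStarRing.norm_mul_mem_unitary _ (Unitary.star_mem hU), CStarRing.norm_mem_unitary_mul _ hU]

variable {𝔸 : Type*} [NormedRing 𝔸] [NormedAlgebra ℝ 𝔸] [CompleteSpace 𝔸] [StarRing 𝔸]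
  [CStarRing 𝔸] [StarModule ℝ 𝔸]

/-- The sum `∑_j S_j A_j S_j⋆` with `S_j = e^{t A_m} ⋯ e^{t A_{j+1}}` for `L = [A_1, …, A_m]`. For
skew-adjoint entries, where `S_j⋆ = S_j⁻¹`, it is the logarithmic derivative `S' S⁻¹` of
`S = expProd L`. -/
noncomputable def logDeriv : List 𝔸 → ℝ → 𝔸
  | [], _ => 0
  | A :: L, t => logDeriv L t + expProd L t * A * star (expProd L t)

theorem exp_smul_mem_unitary {A : 𝔸} (hA : star A = -A) (t : ℝ) :
    NormedSpace.exp (t • A) ∈ unitary 𝔸 := by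
  let _ : NormedAlgebra ℚ 𝔸 := NormedAlgebra.restrictScalars ℚ ℝ 𝔸
  refine NormedSpace.exp_mem_unitary_of_mem_skewAdjoint ?_
  rw [skewAdjoint.mem_iff, star_smul, hA, smul_neg, star_trivial]

theorem expProd_mem_unitary {L : List 𝔸} (hL : ∀ A ∈ L, star A = -A) (t : ℝ) :
    expProd L t ∈ unitary 𝔸 := by
  refine Submonoid.list_prod_mem _ fun U hU => ?_
  simp only [List.mem_reverse, List.mem_map] at hU
  obtain ⟨A, hA, rfl⟩ := hU
  exact exp_smul_mem_unitary (hL A hA) t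

theorem hasDerivAt_expProd {L : List 𝔸} (hL : ∀ A ∈ L, star A = -A) (t : ℝ) :
    HasDerivAt (expProd L) (logDeriv L t * expProd L t) t := by
  induction L with
  | nil => exact (hasDerivAt_const t (1 : 𝔸)).congr_deriv (by simp [logDeriv])
  | cons A L ih =>
    have hL' : ∀ B ∈ L, star B = -B := fun B hB => hL B (by simp [hB])
    have h := (ih hL').mul (hasDerivAt_exp_smul_const' A t)
    have hS : star (expProd L t) * expProd L t = 1 :=
      Unitary.star_mul_self_of_mem (expProd_mem_unitary hL' t)
    have hfun : expProd (A :: L) = fun s => expProd L s * NormedSpace.exp (s • A) :=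
      funext fun s => expProd_cons A L s
    rw [hfun]
    refine h.congr_deriv ?_
    simp only [logDeriv, add_mul, mul_assoc]
    rw [← mul_assoc (star _), hS, one_mul]

/-! ### Taylor expansion of conjugations, with nested commutators as remainder -/

/-- Taylor's formula for `e^{tA} B e^{-tA}` to order `p`. Since conjugation by `e^{tA}` is
isometric, the remainder involves only the `p`-fold commutator. -/
theorem norm_exp_conj_sub_le {A : 𝔸} (hA : star A = -A) (p : ℕ) (B : 𝔸) {t : ℝ} (ht : 0 ≤ t) :
    ‖NormedSpace.exp (t • A) * B * star (NormedSpace.exp (t • A)) -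
      ∑ k ∈ Finset.range p, ((k.factorial : ℝ)⁻¹ * t ^ k) • (fun X => ⁅A, X⁆)^[k] B‖ ≤
      ‖(fun X => ⁅A, X⁆)^[p] B‖ * t ^ p := by
  have hstar : ∀ s : ℝ, star (NormedSpace.exp (s • A)) = NormedSpace.exp (s • -A) := fun s => by
    rw [NormedSpace.star_exp, star_smul, star_trivial, hA]
  induction p generalizing B t with
  | zero =>
    simp [norm_mul_mul_star_of_mem_unitary (exp_smul_mem_unitary hA t)]
  | succ p ih =>
    have hderiv : ∀ s : ℝ, HasDerivAt
        (fun s : ℝ => NormedSpace.exp (s • A) * B * star (NormedSpace.exp (s • A)) -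
          ∑ k ∈ Finset.range (p + 1),
            ((k.factorial : ℝ)⁻¹ * s ^ k) • (fun X => ⁅A, X⁆)^[k] B)
        (NormedSpace.exp (s • A) * ⁅A, B⁆ * star (NormedSpace.exp (s • A)) -
          ∑ k ∈ Finset.range p,
            ((k.factorial : ℝ)⁻¹ * s ^ k) • (fun X => ⁅A, X⁆)^[k] ⁅A, B⁆) s := by
      intro s
      refine HasDerivAt.sub ?_ ?_
      · simp only [hstar]
        refine (((hasDerivAt_exp_smul_const A s).mul_const B).mul
          (hasDerivAt_exp_smul_const' (-A) s)).congr_deriv ?_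
        rw [Ring.lie_def]
        noncomm_ring
      · simp only [Finset.sum_range_succ' _ p, pow_zero]
        have h := HasDerivAt.fun_sum (u := Finset.range p) fun k _ =>
          (((hasDerivAt_pow (k + 1) s).const_mul (((k + 1).factorial : ℝ)⁻¹)).smul_const
            ((fun X => ⁅A, X⁆)^[k + 1] B))
        refine (h.add_const _).congr_deriv ?_
        refine Finset.sum_congr rfl fun k _ => ?_
        rw [Function.iterate_succ_apply, Nat.factorial_succ, add_tsub_cancel_right]
        congr 1
        have : (k.factorial : ℝ) ≠ 0 := by positivity
        push_cast
        field_simp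
    have h := norm_le_of_hasDerivAt_of_norm_le_pow hderiv
      (by simp [Finset.sum_range_succ']) (fun s hs => ih ⁅A, B⁆ hs) ht
    refine h.trans ?_
    rw [Function.iterate_succ_apply]
    gcongr
    exact div_le_self (norm_nonneg _) (by simp)

/-- The innermost exponential is expanded first, to order `p`; its `k`th term carries the factor
`t ^ k`, so that conjugation by the remaining exponentials need only be expanded to order
`p - k`. -/
theorem hasExpansion_expProd_conj {L : List 𝔸} (hL : ∀ A ∈ L, star A = -A) (p : ℕ) (B : 𝔸) :
    HasExpansion (fun t => expProd L t * B * star (expProd L t)) p (commSum L p B) := by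
  induction L generalizing p B with
  | nil =>
    cases p with
    | zero => exact hasExpansion_of_norm_le fun t _ => by simp [expProd, commSum]
    | succ p => simpa [expProd, commSum] using hasExpansion_const B (Nat.le_add_left 1 p)
  | cons A L ih =>
    have hA : star A = -A := hL A (by simp)
    have hL' : ∀ B ∈ L, star B = -B := fun B hB => hL B (by simp [hB])
    set ad : 𝔸 → 𝔸 := fun X => ⁅A, X⁆ with had
    have hpoly : HasExpansion (fun t : ℝ => ∑ k ∈ Finset.range p,
        ((k.factorial : ℝ)⁻¹ * t ^ k) • (expProd L t * ad^[k] B * star (expProd L t))) p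
        (∑ k ∈ Finset.range p, commSum L (p - k) (ad^[k] B)) := by
      refine hasExpansion_sum _ fun k hk => ?_
      have hk := Finset.mem_range.1 hk
      have hfac : |((k.factorial : ℝ)⁻¹)| ≤ 1 := by
        rw [abs_of_nonneg (by positivity)]
        exact inv_le_one_of_one_le₀ (by exact_mod_cast k.factorial_pos)
      have := (ih hL' (p - k) (ad^[k] B)).pow_smul k hfac
      rwa [Nat.add_sub_cancel' hk.le] at this
    have hrem : HasExpansion (fun t : ℝ => expProd L t *
        (NormedSpace.exp (t • A) * B * star (NormedSpace.exp (t • A)) -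
          ∑ k ∈ Finset.range p, ((k.factorial : ℝ)⁻¹ * t ^ k) • ad^[k] B) *
        star (expProd L t)) p (commSum L 0 (ad^[p] B)) := by
      refine hasExpansion_of_norm_le fun t ht => ?_
      rw [norm_mul_mul_star_of_mem_unitary (expProd_mem_unitary hL' t)]
      exact norm_exp_conj_sub_le hA p B ht
    have h := (hpoly.add hrem).mono (K' := commSum (A :: L) p B) <| by
      refine le_trans (le_of_eq ?_) (sum_commSum_iterate_le A L p B)
      rw [Finset.sum_range_succ, Nat.sub_self]
    convert h using 2 with t
    simp only [expProd_cons, star_mul, mul_sub, sub_mul, Finset.mul_sum, Finset.sum_mul,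
      mul_smul_comm, smul_mul_assoc, mul_assoc]
    abel

theorem hasExpansion_logDeriv {L : List 𝔸} (hL : ∀ A ∈ L, star A = -A) (p : ℕ) :
    HasExpansion (logDeriv L) p (L.map (commSum L p)).sum := by
  induction L with
  | nil => exact hasExpansion_of_norm_le fun t _ => by simp [logDeriv]
  | cons A L ih =>
    have hL' : ∀ B ∈ L, star B = -B := fun B hB => hL B (by simp [hB])
    refine ((ih hL').add (hasExpansion_expProd_conj hL' p A)).mono ?_
    rw [List.map_cons, List.sum_cons, add_comm]
    exact add_le_add (commSum_le_commSum_cons A L p A)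
      (List.sum_le_sum fun X _ => commSum_le_commSum_cons A L p X)

/-! ### The local error of a product formula -/

/-- The local error of a product of exponentials of order `p ≥ 1`. The bound holds for all `t ≥ 0`
with a constant read off from the commutators, while the order condition is an asymptotic statement
with an unspecified constant. The generator `H` is a polynomial of degree `0 < p` in the expansion
of `S' S⁻¹ - H`; this is where `p ≥ 1` enters. -/
theorem norm_expProd_sub_exp_le {L : List 𝔸} (hL : ∀ A ∈ L, star A = -A) {H : 𝔸}
    (hH : star H = -H) {p : ℕ} (hp : 1 ≤ p)
    (hord : (fun t : ℝ => expProd L t - NormedSpace.exp (t • H)) =O[𝓝 0]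
      fun t : ℝ => t ^ (p + 1)) {t : ℝ} (ht : 0 ≤ t) :
    ‖expProd L t - NormedSpace.exp (t • H)‖ ≤ (L.map (commSum L p)).sum * t ^ (p + 1) := by
  set K := (L.map (commSum L p)).sum with hK
  have hK0 : 0 ≤ K := List.sum_nonneg fun x hx => by
    obtain ⟨A, -, rfl⟩ := List.mem_map.1 hx
    exact commSum_nonneg _ _ _
  have hU := fun s : ℝ => expProd_mem_unitary hL s
  have hV := fun s : ℝ => exp_smul_mem_unitary hH s
  have hD : ∀ s : ℝ, HasDerivAt (fun s => expProd L s - NormedSpace.exp (s • H))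
      (logDeriv L s * expProd L s - H * NormedSpace.exp (s • H)) s := fun s =>
    (hasDerivAt_expProd hL s).sub (hasDerivAt_exp_smul_const' H s)
  -- With `D = S - e^{tH}` one has `(S' S⁻¹ - H) S = D' - H D`, so that `S' S⁻¹ - H = O(t^p)`.
  have hsmall : (fun s => logDeriv L s - H) =O[𝓝 0] fun s : ℝ => s ^ p := by
    have h1 := isBigO_deriv_of_analyticAt
      ((analyticAt_expProd L 0).sub (analyticAt_exp_smul H 0)) hord
    have h2 : (fun s : ℝ => H * (expProd L s - NormedSpace.exp (s • H))) =O[𝓝 0]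
        fun s : ℝ => s ^ p := by
      refine ((isBigO_const_mul_self H _ _).trans hord).trans ?_
      simpa [pow_succ] using (isBigO_refl (fun s : ℝ => s ^ p) (𝓝 0)).mul
        ((continuousAt_id (x := (0 : ℝ))).isBigO_one ℝ)
    refine IsBigO.trans (IsBigO.of_norm_le fun s => ?_) (h1.sub h2).norm_left
    refine le_of_eq ?_
    have hder : deriv (expProd L - fun s => NormedSpace.exp (s • H)) s = _ := (hD s).deriv
    rw [← CStarRing.norm_mul_mem_unitary _ (hU s), hder]
    congr 1
    noncomm_ring
  have hbound : ∀ s : ℝ, 0 ≤ s → ‖logDeriv L s - H‖ ≤ K * s ^ p := by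
    have hexp := (hasExpansion_logDeriv hL p).add (hasExpansion_const (-H) hp)
    simp only [← sub_eq_add_neg, add_zero] at hexp
    exact fun s hs => hexp.norm_le (hsmall.mono nhdsWithin_le_nhds) hs
  -- Variation of constants: integrate the derivative of `e^{-sH} S(s)`.
  have hW : ∀ s : ℝ, HasDerivAt (fun s : ℝ => NormedSpace.exp (s • -H) * expProd L s - 1)
      (NormedSpace.exp (s • -H) * (logDeriv L s - H) * expProd L s) s := fun s => by
    refine (((hasDerivAt_exp_smul_const (-H) s).mul
      (hasDerivAt_expProd hL s)).sub_const 1).congr_deriv ?_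
    noncomm_ring
  have hH' : star (-H) = -(-H) := by rw [star_neg, hH]
  have hmain := norm_le_of_hasDerivAt_of_norm_le_pow hW (by simp [expProd]) (K := K) (p := p)
    (fun s hs => by
      rw [CStarRing.norm_mul_mem_unitary _ (hU s),
        CStarRing.norm_mem_unitary_mul _ (exp_smul_mem_unitary hH' s)]
      exact hbound s hs) ht
  have hinv : NormedSpace.exp (t • -H) * NormedSpace.exp (t • H) = 1 := by
    have : NormedSpace.exp (t • -H) = star (NormedSpace.exp (t • H)) := by
      rw [NormedSpace.star_exp, star_smul, star_trivial, hH]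
    rw [this, Unitary.star_mul_self_of_mem (hV t)]
  rw [← CStarRing.norm_mem_unitary_mul _ (exp_smul_mem_unitary hH' t), mul_sub, hinv]
  refine hmain.trans ?_
  gcongr
  exact div_le_self hK0 (by simp)

end Unitary

end Trotter

namespace Trotter

/-! ### The local error of a product formula with real coefficients -/

/-- The factors of a product formula, the rightmost one first. -/
noncomputable def factorList {d Υ Γ : ℕ} (a : Fin Υ → Fin Γ → ℝ) (π : Fin Υ → Equiv.Perm (Fin Γ))
    (H : Fin Γ → Op d) : List (Op d) :=
  (List.ofFn fun υ => List.ofFn fun γ => a υ γ • H (π υ γ)).flatten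

section

variable {d Υ Γ : ℕ} {a : Fin Υ → Fin Γ → ℝ} {π : Fin Υ → Equiv.Perm (Fin Γ)} {H : Fin Γ → Op d}

theorem productFormula_eq_expProd (t : ℝ) :
    productFormula a π H t = expProd (factorList a π H) t := by
  simp only [productFormula, leftProd, expProd, factorList, List.map_flatten, List.reverse_flatten,
    List.prod_flatten, List.map_ofFn, List.map_reverse, Function.comp_def, smul_smul]

theorem star_eq_neg_of_mem_factorList (hH : ∀ γ, star (H γ) = -H γ) :
    ∀ A ∈ factorList a π H, star A = -A := by
  intro A hA
  simp only [factorList, List.mem_flatten, List.mem_ofFn'] at hA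
  obtain ⟨l, ⟨υ, rfl⟩, hA⟩ := hA
  obtain ⟨γ, rfl⟩ := (List.mem_ofFn' _ _).1 hA
  rw [star_smul, hH, smul_neg, star_trivial]

/-- Each stage of the formula uses every summand once, with a coefficient at most `1`. -/
theorem sum_factorList_le (ha : ∀ υ γ, |a υ γ| ≤ 1) (f : Op d → ℝ) (hf : ∀ A, 0 ≤ f A)
    (hf' : ∀ (a : ℝ) A, f (a • A) = |a| * f A) :
    ((factorList a π H).map f).sum ≤ Υ * ((List.ofFn H).map f).sum := by
  simp only [factorList, List.map_flatten, List.sum_flatten, List.map_ofFn, List.sum_ofFn,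
    Function.comp_def, hf']
  calc ∑ υ, ∑ γ, |a υ γ| * f (H (π υ γ)) ≤ ∑ υ : Fin Υ, ∑ γ, f (H (π υ γ)) := by
        gcongr with υ _ γ _
        exact mul_le_of_le_one_left (hf _) (ha υ γ)
    _ = ∑ _υ : Fin Υ, ∑ γ, f (H γ) :=
        Finset.sum_congr rfl fun υ _ => Equiv.sum_comp (π υ) fun γ => f (H γ)
    _ = Υ * ∑ γ, f (H γ) := by simp

/-- The commutators of `alphaComm` can be summed from the inside out. -/
theorem sum_commSum_nestedCommutator (n q : ℕ) :
    ∑ g : Fin (n + 1) → Fin Γ, commSum (List.ofFn H) q (nestedCommutator n fun i => H (g i)) =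
      alphaComm (n + q) H := by
  induction q generalizing n with
  | zero => rfl
  | succ q ih =>
    rw [show n + (q + 1) = n + 1 + q by ring, ← ih (n + 1),
      ← (Fin.snocEquiv fun _ : Fin (n + 1 + 1) => Fin Γ).sum_comp, Fintype.sum_prod_type,
      Finset.sum_comm]
    refine Finset.sum_congr rfl fun g _ => ?_
    simp [commSum, List.map_ofFn, List.sum_ofFn, nestedCommutator, Fin.snocEquiv]

theorem sum_commSum_eq_alphaComm (p : ℕ) :
    ((List.ofFn H).map (commSum (List.ofFn H) p)).sum = alphaComm p H := by
  rw [← Nat.zero_add p, ← sum_commSum_nestedCommutator, Nat.zero_add, List.map_ofFn, List.sum_ofFn,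
    ← (Equiv.funUnique (Fin 1) (Fin Γ)).symm.sum_comp]
  rfl

theorem alphaComm_nonneg (p : ℕ) (H : Fin Γ → Op d) : 0 ≤ alphaComm p H :=
  Finset.sum_nonneg fun _ _ => norm_nonneg _

theorem norm_productFormula_sub_evolution_le (hH : ∀ γ, star (H γ) = -H γ)
    (ha : ∀ υ γ, |a υ γ| ≤ 1) {p : ℕ} (hp : 1 ≤ p) (hord : IsOrder p a π H) {t : ℝ} (ht : 0 ≤ t) :
    ‖productFormula a π H t - evolution H t‖ ≤
      (Υ : ℝ) ^ (p + 1) * alphaComm p H * t ^ (p + 1) := by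
  have hsum : star (∑ γ, H γ) = -∑ γ, H γ := by simp [star_sum, hH]
  unfold IsOrder at hord
  simp only [productFormula_eq_expProd, evolution] at hord ⊢
  refine (norm_expProd_sub_exp_le (star_eq_neg_of_mem_factorList hH) hsum hp hord ht).trans ?_
  gcongr
  rw [← sum_commSum_eq_alphaComm]
  exact sum_commSum_le_pow_mul (Nat.cast_nonneg Υ) (sum_factorList_le ha) p

/-! ### Accumulating the error over the Trotter steps -/

theorem norm_pow_sub_pow_le_of_mem_unitary {𝔸 : Type*} [NormedRing 𝔸] [StarRing 𝔸] [CStarRing 𝔸]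
    {U V : 𝔸} (hU : U ∈ unitary 𝔸) (hV : V ∈ unitary 𝔸) (r : ℕ) :
    ‖U ^ r - V ^ r‖ ≤ r * ‖U - V‖ := by
  induction r with
  | zero => simp
  | succ r ih =>
    have : U ^ (r + 1) - V ^ (r + 1) = U ^ r * (U - V) + (U ^ r - V ^ r) * V := by
      simp only [pow_succ]
      noncomm_ring
    rw [this]
    refine (norm_add_le _ _).trans ?_
    rw [CStarRing.norm_mem_unitary_mul _ (pow_mem hU r), CStarRing.norm_mul_mem_unitary _ hV]
    push_cast
    linarith

theorem norm_productFormula_pow_sub_evolution_le (hH : ∀ γ, star (H γ) = -H γ)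
    (ha : ∀ υ γ, |a υ γ| ≤ 1) {p : ℕ} (hp : 1 ≤ p) (hord : IsOrder p a π H) {t : ℝ} (ht : 0 ≤ t)
    {r : ℕ} (hr : 1 ≤ r) :
    ‖productFormula a π H (t / r) ^ r - evolution H t‖ ≤
      (Υ : ℝ) ^ (p + 1) * (alphaComm p H * t ^ (p + 1) / r ^ p) := by
  have hr0 : (0 : ℝ) < r := by exact_mod_cast hr
  have hsum : star (∑ γ, H γ) = -∑ γ, H γ := by simp [star_sum, hH]
  have hevol : evolution H t = evolution H (t / r) ^ r := by
    rw [evolution, evolution, ← Matrix.exp_nsmul, ← Nat.cast_smul_eq_nsmul ℝ, smul_smul,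
      mul_div_cancel₀ _ hr0.ne']
  have hU : productFormula a π H (t / r) ∈ unitary (Op d) := by
    rw [productFormula_eq_expProd]
    exact expProd_mem_unitary (star_eq_neg_of_mem_factorList hH) _
  have hV : evolution H (t / r) ∈ unitary (Op d) := exp_smul_mem_unitary hsum _
  rw [hevol]
  calc _ ≤ r * ‖productFormula a π H (t / r) - evolution H (t / r)‖ :=
        norm_pow_sub_pow_le_of_mem_unitary hU hV r
    _ ≤ r * ((Υ : ℝ) ^ (p + 1) * alphaComm p H * (t / r) ^ (p + 1)) := by
        gcongr
        exact norm_productFormula_sub_evolution_le hH ha hp hord (by positivity)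
    _ = _ := by
        rw [div_pow, pow_succ (r : ℝ) p]
        field_simp

theorem trotterScale_nonneg (p : ℕ) (H : Fin Γ → Op d) {t ε : ℝ} (ht : 0 ≤ t) (hε : 0 < ε) :
    0 ≤ trotterScale p H t ε := by
  have := alphaComm_nonneg p H
  unfold trotterScale
  positivity

theorem trotterScale_pow {p : ℕ} (hp : 1 ≤ p) {t ε : ℝ} (ht : 0 ≤ t) (hε : 0 < ε) :
    trotterScale p H t ε ^ p = alphaComm p H * t ^ (p + 1) / ε := by
  have hα := alphaComm_nonneg p H
  have hp0 : (p : ℝ) ≠ 0 := by positivity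
  have h1 : ∀ x : ℝ, 0 ≤ x → (x ^ (1 / p : ℝ)) ^ p = x := fun x hx => by
    rw [← Real.rpow_mul_natCast hx, one_div_mul_cancel hp0, Real.rpow_one]
  have h2 : (t ^ (1 + 1 / p : ℝ)) ^ p = t ^ (p + 1) := by
    rw [← Real.rpow_mul_natCast ht, ← Real.rpow_natCast]
    congr 1
    push_cast
    field_simp
  rw [trotterScale, div_pow, mul_pow, h1 _ hα, h1 _ hε.le, h2]

/-- With at least `c` times the Trotter scale many steps, the error is at most
`(Υ ^ (p + 1) / c ^ p) * ε`. -/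
theorem norm_productFormula_pow_sub_evolution_le_of_scale (hH : ∀ γ, star (H γ) = -H γ)
    (ha : ∀ υ γ, |a υ γ| ≤ 1) {p : ℕ} (hp : 1 ≤ p) (hord : IsOrder p a π H) {t ε c : ℝ}
    (ht : 0 ≤ t) (hε : 0 < ε) (hc : 0 < c) {r : ℕ} (hr : 1 ≤ r)
    (hcr : c * trotterScale p H t ε ≤ r) :
    ‖productFormula a π H (t / r) ^ r - evolution H t‖ ≤ (Υ : ℝ) ^ (p + 1) / c ^ p * ε := by
  have hr0 : (0 : ℝ) < r := by exact_mod_cast hr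
  have hX := trotterScale_nonneg p H ht hε
  refine (norm_productFormula_pow_sub_evolution_le hH ha hp hord ht hr).trans ?_
  rw [div_mul_eq_mul_div, mul_div_assoc (_ ^ (p + 1)) ε]
  refine mul_le_mul_of_nonneg_left ?_ (by positivity)
  rw [div_le_div_iff₀ (by positivity) (by positivity)]
  have h := pow_le_pow_left₀ (by positivity) hcr p
  rw [mul_pow, trotterScale_pow hp ht hε, ← mul_div_assoc, div_le_iff₀ hε] at h
  linarith

end

end Trotter

theorem corollary3p5 (p Υ : ℕ) (hp : 1 ≤ p) :
    (∀ c : ℝ, 0 < c → ∃ C : ℝ, 0 < C ∧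
      ∀ (d Γ : ℕ) (H : Fin Γ → Trotter.Op d)
        (a : Fin Υ → Fin Γ → ℝ) (π : Fin Υ → Equiv.Perm (Fin Γ)),
        (∀ γ, (H γ).conjTranspose = -H γ) →
        (∀ υ γ, |a υ γ| ≤ 1) →
        Trotter.IsOrder p a π H →
        ∀ t ε : ℝ, 0 ≤ t → 0 < ε → ∀ r : ℕ, 1 ≤ r →
          c * Trotter.trotterScale p H t ε ≤ r →
          ‖Trotter.productFormula a π H (t / r) ^ r - Trotter.evolution H t‖ ≤ C * ε) ∧
    (∃ C : ℝ, 0 < C ∧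
      ∀ (d Γ : ℕ) (H : Fin Γ → Trotter.Op d)
        (a : Fin Υ → Fin Γ → ℝ) (π : Fin Υ → Equiv.Perm (Fin Γ)),
        (∀ γ, (H γ).conjTranspose = -H γ) →
        (∀ υ γ, |a υ γ| ≤ 1) →
        Trotter.IsOrder p a π H →
        ∀ t ε : ℝ, 0 ≤ t → 0 < ε → ∃ r : ℕ, 1 ≤ r ∧
          (r : ℝ) ≤ 1 + C * Trotter.trotterScale p H t ε ∧
          ‖Trotter.productFormula a π H (t / r) ^ r - Trotter.evolution H t‖ ≤ ε) := by
  constructor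
  · -- Adding `1` keeps the constant positive when `Υ = 0`.
    intro c hc
    refine ⟨(Υ : ℝ) ^ (p + 1) / c ^ p + 1, by positivity, ?_⟩
    intro d Γ H a π hH ha hord t ε ht hε r hr hcr
    refine (Trotter.norm_productFormula_pow_sub_evolution_le_of_scale hH ha hp hord ht hε hc hr
      hcr).trans ?_
    gcongr
    exact le_add_of_nonneg_right zero_le_one
  · -- The constant `c = Υ ^ (p + 1) + 1` satisfies `Υ ^ (p + 1) ≤ c ≤ c ^ p`.
    set c : ℝ := (Υ : ℝ) ^ (p + 1) + 1 with hc_def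
    have hc : 0 < c := by positivity
    refine ⟨c, hc, ?_⟩
    intro d Γ H a π hH ha hord t ε ht hε
    have hX := Trotter.trotterScale_nonneg p H ht hε
    refine ⟨⌊c * Trotter.trotterScale p H t ε⌋₊ + 1, by omega, ?_, ?_⟩
    · push_cast
      linarith [Nat.floor_le (mul_nonneg hc.le hX)]
    · refine (Trotter.norm_productFormula_pow_sub_evolution_le_of_scale hH ha hp hord ht hε hc
        (by omega) ?_).trans ?_
      · push_cast
        exact (Nat.lt_floor_add_one _).le
      · refine mul_le_of_le_one_left hε.le ((div_le_one (by positivity)).2 ?_)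
        have h1 : 1 ≤ c := le_add_of_nonneg_left (by positivity)
        exact (le_add_of_nonneg_right zero_le_one).trans (le_self_pow₀ h1 (by omega))
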